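/- Let $R$ be a commutative noetherian ring. Let $\mathcal{G}$ be the collection of finitely generated Gorenstein projective $R$-modules, where a module is Gorenstein projective if it is the cokernel of a differential of an acyclic complex $T$ of projective $R$-modules such that $\operatorname{Hom}_R(T,Q)$ is acyclic for every projective $R$-module $Q$. For a complex $M$ in the derived category $D(R)$, the level $\operatorname{level}_{\mathcal{G}}(M)\in\mathbb{N}\cup\{\infty\}$ is $0$ if $M\simeq 0$; it is at most $1$ if $M$ can be built from modules in $\mathcal{G}$ (placed in degree $0$) by shifts, finite direct sums and direct summands; for $n\ge 2$ it is at most $n$ if there is an exact triangle $K\to L\oplus M\to N\to$ with $\operatorname{level}_{\mathcal{G}}(K)\le 1$ and $\operatorname{level}_{\mathcal{G}}(N)\le n-1$; and the level is the least $n$ for which it is at most $n$ in this sense ($\infty$ if there is none). Assume that $R$ is Cohen--Macaulay of finite Krull dimension. Then there is a bounded complex $F$ of finitely generated free $R$-modules with $$\operatorname{level}_{\mathcal{G}}(F)\ \ge\ \dim R+1 .$$ Moreover, if $R$ is local, then $R$ has a sequence of parameters (a sequence of $\dim R$ elements that generates an ideal whose radical is the maximal ideal), and for every such sequence the Koszul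 complex $K$ on it is a bounded complex of finitely generated free $R$-modules with $$\operatorname{level}_{\mathcal{G}}(K)\ =\ \dim R+1 .$$ -/

import Mathlib

open CategoryTheory CategoryTheory.Limits

universe w v u

/-! ### Levels in a triangulated category -/

section Level

variable {C : Type u} [Category.{v} C] [HasZeroObject C] [HasShift C ℤ] [Preadditive C]
  [∀ n : ℤ, (shiftFunctor C n).Additive] [Pretriangulated C]

open Classical in
/-- The level of `X` with respect to a collection `P` of objects: it is `0` if `X` is zero, and
otherwise the least `m ≥ 1` such that `X` can be built from `P` by shifts, finite direct sums and
direct summands together with at most `m - 1` mapping cones (it is `⊤` if there is no such `m`).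
In Mathlib, `P.triangEnvelopeIter 0` is the closure of `P` under shifts, binary direct sums and
direct summands, and `M` satisfies `P.triangEnvelopeIter (n + 1)` iff `M` is a direct summand of
the middle term of a distinguished triangle `K ⟶ M' ⟶ N ⟶ K⟦1⟧` with `K` in
`P.triangEnvelopeIter 0` and `N` in `P.triangEnvelopeIter n`. -/
noncomputable def level (P : ObjectProperty C) (X : C) : ℕ∞ :=
  if IsZero X then 0 else ⨅ (n : ℕ) (_ : P.triangEnvelopeIter n X), ((n : ℕ∞) + 1)

end Level

section CommutativeAlgebra

variable (R : Type u) [CommRing R]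

/-! ### Gorenstein projective modules and G-levels -/

/-- An acyclic complex `T` of projective modules is totally acyclic if `Hom(T, Q)` is acyclic for
every projective module `Q`. -/
structure IsTotallyAcyclic (T : CochainComplex (ModuleCat.{u} R) ℤ) : Prop where
  projective (i : ℤ) : Projective (T.X i)
  acyclic : T.Acyclic
  hom_exact (Q : ModuleCat.{u} R) [Projective Q] (i : ℤ) (f : T.X i ⟶ Q)
    (hf : T.d (i - 1) i ≫ f = 0) : ∃ g : T.X (i + 1) ⟶ Q, T.d i (i + 1) ≫ g = f

/-- A module is Gorenstein projective if it is the cokernel of a differential of a totally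
acyclic complex of projective modules (`T.opcycles 0` is the cokernel of `T.X (-1) ⟶ T.X 0`). -/
def IsGorensteinProjective (M : ModuleCat.{u} R) : Prop :=
  ∃ T : CochainComplex (ModuleCat.{u} R) ℤ, IsTotallyAcyclic R T ∧ Nonempty (M ≅ T.opcycles 0)

/-- The collection of finitely generated Gorenstein projective modules, viewed as complexes
concentrated in degree `0`, in the derived category. -/
def gorensteinProjectives [HasDerivedCategory.{w} (ModuleCat.{u} R)] :
    ObjectProperty (DerivedCategory (ModuleCat.{u} R)) := fun X =>
  ∃ G : ModuleCat.{u} R, Module.Finite R G ∧ IsGorensteinProjective R G ∧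
    Nonempty (X ≅ (DerivedCategory.singleFunctor (ModuleCat.{u} R) 0).obj G)

/-- The G-level of a complex. -/
noncomputable def gLevel [HasDerivedCategory.{w} (ModuleCat.{u} R)]
    (F : CochainComplex (ModuleCat.{u} R) ℤ) : ℕ∞ :=
  level (gorensteinProjectives R) (DerivedCategory.Q.obj F)

/-! ### Bounded complexes of finitely generated free modules, Koszul complexes -/

/-- `F` is a bounded complex of finitely generated free modules. -/
structure IsBoundedFiniteFree (F : CochainComplex (ModuleCat.{u} R) ℤ) : Prop where
  bounded : ∃ a b : ℤ, ∀ i : ℤ, i < a ∨ b < i → IsZero (F.X i)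
  finite (i : ℤ) : Module.Finite R (F.X i)
  free (i : ℤ) : Module.Free R (F.X i)

/-- The Koszul complex `K(x₁, …, xₙ) = K(x₁) ⊗ ⋯ ⊗ K(xₙ)` on a sequence, in cohomological degrees
`-n, …, 0`. Here `K(x)` is the complex `R ⟶ R` given by multiplication by `x`, so that
`K(x) ⊗ L` is the mapping cone of multiplication by `x` on `L`. -/
noncomputable def koszulComplex : List R → CochainComplex (ModuleCat.{u} R) ℤ
  | [] => (CochainComplex.singleFunctor (ModuleCat.{u} R) 0).obj (ModuleCat.of R R)
  | x :: xs => CochainComplex.mappingCone (x • 𝟙 (koszulComplex xs))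

/-! ### Cohen–Macaulay rings and sequences of parameters -/

/-- The depth of a (noetherian) local ring: the supremum of the lengths of regular sequences in
the maximal ideal. -/
noncomputable def localDepth [IsLocalRing R] : ℕ∞ :=
  ⨆ (rs : List R) (_ : (∀ r ∈ rs, r ∈ IsLocalRing.maximalIdeal R) ∧
    RingTheory.Sequence.IsRegular R rs), (rs.length : ℕ∞)

/-- A (noetherian) ring is Cohen–Macaulay if the depth of each of its localizations at a maximal
ideal is equal to the Krull dimension of that localization. -/
def IsCohenMacaulay : Prop :=
  ∀ (m : Ideal R) [m.IsMaximal],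
    ((localDepth (Localization.AtPrime m) : ℕ∞) : WithBot ℕ∞) =
      ringKrullDim (Localization.AtPrime m)

/-- A sequence of parameters (that is, a full system of parameters) of a (noetherian) local ring
`R`: a sequence of `dim R` elements that generates an ideal primary to the maximal ideal, i.e. an
ideal whose radical is the maximal ideal. -/
def IsParameterSequence [IsLocalRing R] (rs : List R) : Prop :=
  ((rs.length : ℕ∞) : WithBot ℕ∞) = ringKrullDim R ∧
    (Ideal.ofList rs).radical = IsLocalRing.maximalIdeal R

end CommutativeAlgebra

/-! For a finitely generated module `M` of projective dimension `d`, the G-level is exactly `d + 1`.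
A resolution by finitely generated projectives, which are Gorenstein projective, gives the upper
bound. The lower bound is a ghost argument. Gorenstein projectives have no higher Ext into modules
of finite projective dimension, so each connecting morphism `M ⟶ ΩM⟦1⟧` kills every map from a shift
of a Gorenstein projective. By the ghost lemma a composite of `d` such morphisms kills every map
from an object of level at most `d`. The composite for the successive syzygies of `M` is a nonzero
class in `Ext^d(M, Ω^d M)`, and applying it to the identity of `M` shows that the level exceeds `d`
(`level_singleFunctor_eq`).

The Koszul complex on a regular sequence of length `d` inside a proper ideal resolves a module of
projective dimension exactly `d`, so its level is `d + 1` (`gLevel_koszulComplex`). It remains to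
find regular sequences of length `dim R`. Some maximal ideal has height `dim R`, and the
Cohen–Macaulay condition at its localization yields such a sequence already in `R`
(`IsCohenMacaulay.exists_isWeaklyRegular`). In the local case every sequence of parameters is
regular, because `dim R / p` is at least the depth for each associated prime `p`
(`IsParameterSequence.isWeaklyRegular`). -/

/-! ### Ghost morphisms and bounds on levels -/

section Ghost

section Annihilated

variable {C : Type u} [Category.{v} C] [Preadditive C]

/-- The objects all of whose morphisms to `Y` are annihilated by `f : Y ⟶ Z`. -/
def annihilatedBy {Y Z : C} (f : Y ⟶ Z) : ObjectProperty C :=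
  fun X => ∀ g : X ⟶ Y, g ≫ f = 0

instance annihilatedBy_isStableUnderRetracts {Y Z : C} (f : Y ⟶ Z) :
    (annihilatedBy f).IsStableUnderRetracts where
  of_retract {X X'} r h g := by
    have := h (r.r ≫ g)
    rw [← Category.id_comp g, ← r.retract, Category.assoc, Category.assoc, ← Category.assoc r.r,
      this, comp_zero]

instance annihilatedBy_isClosedUnderBinaryProducts [HasBinaryBiproducts C] {Y Z : C} (f : Y ⟶ Z) :
    (annihilatedBy f).IsClosedUnderBinaryProducts where
  limitsOfShape_le := by
    rintro X ⟨p⟩ g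
    have hb := BinaryBiproduct.isLimit
      (p.diag.obj ⟨WalkingPair.left⟩) (p.diag.obj ⟨WalkingPair.right⟩)
    let e : X ≅ p.diag.obj ⟨WalkingPair.left⟩ ⊞ p.diag.obj ⟨WalkingPair.right⟩ :=
      p.isLimit.conePointsIsoOfNatIso hb (diagramIsoPair _)
    have key : e.inv ≫ g ≫ f = 0 := by
      apply biprod.hom_ext'
      · have := p.prop_diag_obj ⟨WalkingPair.left⟩ (biprod.inl ≫ e.inv ≫ g)
        simpa using this
      · have := p.prop_diag_obj ⟨WalkingPair.right⟩ (biprod.inr ≫ e.inv ≫ g)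
        simpa using this
    simpa using congrArg (fun t => e.hom ≫ t) key

lemma annihilatedBy_le_comp {Y Z W : C} (f : Y ⟶ Z) (h : Z ⟶ W) :
    annihilatedBy f ≤ annihilatedBy (f ≫ h) := by
  intro X hX g
  rw [← Category.assoc, hX g, zero_comp]

end Annihilated

open Pretriangulated

variable {C : Type u} [Category.{v} C] [HasZeroObject C] [HasShift C ℤ] [Preadditive C]
  [∀ n : ℤ, (shiftFunctor C n).Additive] [Pretriangulated C]

/-- Being annihilated by `f` passes to finite products and retracts, so only shifts of generators
need testing. -/
lemma triangEnvelopeIter_zero_le_annihilatedBy {P : ObjectProperty C} {Y Z : C} (f : Y ⟶ Z)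
    (h : ∀ G, P G → ∀ (n : ℤ) (g : G⟦n⟧ ⟶ Y), g ≫ f = 0) :
    P.triangEnvelopeIter 0 ≤ annihilatedBy f := by
  rw [ObjectProperty.triangEnvelopeIter_zero, ObjectProperty.retractClosure_le_iff]
  refine ObjectProperty.limitsClosure_le ?_
  rintro X ⟨G, n, e, hG⟩ g
  have := h G hG n (e.inv ≫ g)
  simpa using congrArg (fun t => e.hom ≫ t) this

/-- The ghost lemma. -/
lemma triangEnvelopeIter_succ_le_annihilatedBy {P : ObjectProperty C} {n : ℕ} {Y Z W : C}
    (f : Y ⟶ Z) (h : Z ⟶ W) (hf : P.triangEnvelopeIter 0 ≤ annihilatedBy f)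
    (hh : P.triangEnvelopeIter n ≤ annihilatedBy h) :
    P.triangEnvelopeIter (n + 1) ≤ annihilatedBy (f ≫ h) := by
  rw [ObjectProperty.triangEnvelopeIter_succ, ObjectProperty.retractClosure_le_iff,
    ← ObjectProperty.triangEnvelopeIter_zero]
  rintro X ⟨K, N, a, b, c, hT, hK, hN⟩ g
  have h0 : a ≫ g ≫ f = 0 := by simpa using hf K hK (a ≫ g)
  -- Since `f` kills the restriction of `g` to `K`, the map `g ≫ f` factors through `N`, where `h`
  -- kills it.
  obtain ⟨t, ht⟩ : ∃ t : N ⟶ Z, g ≫ f = b ≫ t := Triangle.yoneda_exact₂ _ hT (g ≫ f) h0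
  rw [← Category.assoc, ht, Category.assoc, hh N hN t, comp_zero]

lemma triangEnvelopeIter_le_annihilatedBy_shift {P : ObjectProperty C} {n : ℕ} {Y Z : C}
    (f : Y ⟶ Z) (hf : P.triangEnvelopeIter n ≤ annihilatedBy f) (a : ℤ) :
    P.triangEnvelopeIter n ≤ annihilatedBy (f⟦a⟧') := by
  intro X hX g
  let e : X⟦-a⟧⟦a⟧ ≅ X := (shiftEquiv C a).counitIso.app X
  obtain ⟨g', hg'⟩ := (shiftFunctor C a).map_surjective (e.hom ≫ g)
  have h := hf _ ((P.triangEnvelopeIter n).le_shift (-a) _ hX) g'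
  have h' : (e.hom ≫ g) ≫ f⟦a⟧' = 0 := by rw [← hg', ← Functor.map_comp, h, Functor.map_zero]
  simpa using congrArg (fun t => e.inv ≫ t) h'

lemma level_le_of_triangEnvelopeIter {P : ObjectProperty C} {X : C} {n : ℕ}
    (h : P.triangEnvelopeIter n X) : level P X ≤ (n : ℕ∞) + 1 := by
  unfold level
  split_ifs
  · exact bot_le
  · exact iInf₂_le n h

lemma one_le_level {P : ObjectProperty C} {X : C} (hX : ¬ IsZero X) : 1 ≤ level P X := by
  unfold level
  rw [if_neg hX]
  exact le_iInf₂ fun n _ => le_add_self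

/-- The iterates increase with `n`, and for nonzero objects iterate `n` means level at most `n + 1`;
hence the bound `n + 2`. -/
lemma le_level_of_not_triangEnvelopeIter {P : ObjectProperty C} {X : C} {n : ℕ}
    (hX : ¬ IsZero X) (h : ¬ P.triangEnvelopeIter n X) : (n : ℕ∞) + 1 + 1 ≤ level P X := by
  unfold level
  rw [if_neg hX]
  refine le_iInf₂ fun k hk => ?_
  have : n + 1 ≤ k := by
    by_contra hlt
    exact h (P.monotone'_triangEnvelopeIter (by lia) _ hk)
  gcongr
  exact_mod_cast this

lemma level_eq_of_iso (P : ObjectProperty C) {X Y : C} (e : X ≅ Y) : level P X = level P Y := by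
  have h (n : ℕ) : P.triangEnvelopeIter n X ↔ P.triangEnvelopeIter n Y :=
    ObjectProperty.prop_iff_of_iso _ e
  by_cases hX : IsZero X
  · rw [level, level, if_pos hX, if_pos (e.isZero_iff.mp hX)]
  · simp only [level, if_neg hX, if_neg (fun hY => hX (e.isZero_iff.mpr hY)), h]

end Ghost

/-! ### Gorenstein projective modules and vanishing of Ext -/

section GorensteinProjective

open Abelian

variable {R : Type u} [CommRing R]

/-- The short complex `T.opcycles i ⟶ T.X (i + 1) ⟶ T.opcycles (i + 1)`. -/
noncomputable abbrev opcyclesShortComplex (T : CochainComplex (ModuleCat.{u} R) ℤ) (i : ℤ) :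
    ShortComplex (ModuleCat.{u} R) :=
  ShortComplex.mk (T.fromOpcycles i (i + 1)) (T.pOpcycles (i + 1)) (by
    rw [← cancel_epi (T.pOpcycles i)]
    simp)

lemma opcyclesShortComplex_shortExact {T : CochainComplex (ModuleCat.{u} R) ℤ} (hT : T.Acyclic)
    (i : ℤ) : (opcyclesShortComplex T i).ShortExact := by
  have hmono : Mono (T.fromOpcycles i (i + 1)) := by
    refine Preadditive.mono_of_isZero_kernel' _ (T.homologyIsKernel i (i + 1) (by simp)) ?_
    exact (hT i).isZero_homology
  have hexact : (opcyclesShortComplex T i).Exact := by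
    refine ShortComplex.exact_of_g_is_cokernel _ ?_
    refine CokernelCofork.IsColimit.ofπ _ _
      (fun k hk => T.descOpcycles k i (by simp) (by
        rw [← T.p_fromOpcycles i (i + 1), Category.assoc, hk, comp_zero]))
      (fun k hk => by simp) (fun k hk m hm => by
        rw [← cancel_epi (T.pOpcycles (i + 1)), hm]
        simp)
  exact { exact := hexact, mono_f := hmono, epi_g := inferInstanceAs (Epi (T.pOpcycles (i + 1))) }

/-- Dimension shifting along `opcyclesShortComplex` lowers the Ext degree together with `i`. In
degree one, `hom_exact` extends a map `T.opcycles i ⟶ Q` to `T.X (i + 1)`, so its connecting class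
vanishes. -/
lemma IsTotallyAcyclic.ext_opcycles_eq_zero {T : CochainComplex (ModuleCat.{u} R) ℤ}
    (hT : IsTotallyAcyclic R T) (Q : ModuleCat.{u} R) [Projective Q] (n : ℕ) (i : ℤ)
    (α : Ext (T.opcycles i) Q (n + 1)) : α = 0 := by
  induction n generalizing i with
  | zero =>
    obtain ⟨i, rfl⟩ : ∃ j, i = j + 1 := ⟨i - 1, by ring⟩
    have hS := opcyclesShortComplex_shortExact hT.acyclic i
    have := hT.projective (i + 1)
    obtain ⟨x, rfl⟩ := Ext.contravariant_sequence_exact₃ hS Q α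
      (Ext.eq_zero_of_projective _) (n₀ := 0) rfl
    obtain ⟨f, rfl⟩ := (Ext.mk₀_bijective _ _).2 x
    obtain ⟨g, hg⟩ := hT.hom_exact Q i (T.pOpcycles i ≫ f) (by simp)
    have hf : f = T.fromOpcycles i (i + 1) ≫ g := by
      rw [← cancel_epi (T.pOpcycles i), ← hg]
      simp
    rw [hf, ← Ext.mk₀_comp_mk₀]
    exact hS.extClass_comp_assoc _
  | succ n ih =>
    obtain ⟨i, rfl⟩ : ∃ j, i = j + 1 := ⟨i - 1, by ring⟩
    have hS := opcyclesShortComplex_shortExact hT.acyclic i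
    have := hT.projective (i + 1)
    obtain ⟨x, rfl⟩ := Ext.contravariant_sequence_exact₃ hS Q α
      (Ext.eq_zero_of_projective _) (n₀ := n + 1) (by lia)
    rw [ih i x, Ext.comp_zero]

lemma IsGorensteinProjective.ext_eq_zero_of_projective {G : ModuleCat.{u} R}
    (hG : IsGorensteinProjective R G) (Q : ModuleCat.{u} R) [Projective Q] (n : ℕ)
    (α : Ext G Q (n + 1)) : α = 0 := by
  obtain ⟨T, hT, ⟨e⟩⟩ := hG
  have h := hT.ext_opcycles_eq_zero Q n 0 ((Ext.mk₀ e.inv).comp α (zero_add _))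
  simpa using congrArg (fun t => (Ext.mk₀ e.hom).comp t (zero_add _)) h

lemma exists_shortExact_projective (M : ModuleCat.{u} R) :
    ∃ S : ShortComplex (ModuleCat.{u} R), S.ShortExact ∧ Projective S.X₂ ∧ S.X₃ = M :=
  ⟨M.projectiveShortComplex, M.shortExact_projectiveShortComplex,
    inferInstance, rfl⟩

/-- Gorenstein projective modules have no higher extensions by modules of finite projective
dimension. -/
lemma IsGorensteinProjective.ext_eq_zero {G : ModuleCat.{u} R}
    (hG : IsGorensteinProjective R G) (d : ℕ) (M : ModuleCat.{u} R)
    [HasProjectiveDimensionLT M (d + 1)] (n : ℕ) (α : Ext G M (n + 1)) : α = 0 := by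
  induction d generalizing M n with
  | zero =>
    have : Projective M := projective_iff_hasProjectiveDimensionLT_one.mpr ‹_›
    exact hG.ext_eq_zero_of_projective M n α
  | succ d ih =>
    obtain ⟨S, hS, hP, rfl⟩ := exists_shortExact_projective M
    have := (hS.hasProjectiveDimensionLT_X₃_iff d hP).mp ‹_›
    obtain ⟨x, rfl⟩ := Ext.covariant_sequence_exact₃ G hS α rfl (ih S.X₁ (n + 1) _)
    rw [hG.ext_eq_zero_of_projective S.X₂ n x, Ext.zero_comp]

/-- The endomorphism of `P ⊞ P` which has kernel and image equal to the first summand. -/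
noncomputable def biprodShift (P : ModuleCat.{u} R) : P ⊞ P ⟶ P ⊞ P := biprod.snd ≫ biprod.inl

lemma biprodShift_comp_self (P : ModuleCat.{u} R) : biprodShift P ≫ biprodShift P = 0 := by
  simp [biprodShift]

lemma eq_comp_biprodShift {P A : ModuleCat.{u} R} (k : A ⟶ P ⊞ P) (hk : k ≫ biprodShift P = 0) :
    k = (k ≫ biprod.fst ≫ biprod.inr) ≫ biprodShift P := by
  have h : k ≫ biprod.snd = 0 := by
    simpa [biprodShift] using congrArg (fun t => t ≫ biprod.fst) hk
  apply biprod.hom_ext <;> simp [biprodShift, h]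

lemma eq_biprodShift_comp {P A : ModuleCat.{u} R} (k : P ⊞ P ⟶ A) (hk : biprodShift P ≫ k = 0) :
    k = biprodShift P ≫ (biprod.fst ≫ biprod.inr ≫ k) := by
  have h : biprod.inl ≫ k = 0 := by
    simpa [biprodShift] using congrArg (fun t => biprod.inr ≫ t) hk
  apply biprod.hom_ext' <;> simp [biprodShift, h]

/-- The complex `⋯ ⟶ P ⊞ P ⟶ P ⊞ P ⟶ ⋯` with all differentials equal to `biprodShift P`. -/
noncomputable def biprodSelfComplex (P : ModuleCat.{u} R) : CochainComplex (ModuleCat.{u} R) ℤ where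
  X _ := P ⊞ P
  d i j := if i + 1 = j then biprodShift P else 0
  shape i j h := if_neg h
  d_comp_d' i j k h h' := by
    rw [if_pos (show i + 1 = j from h), if_pos (show j + 1 = k from h'), biprodShift_comp_self]

lemma biprodSelfComplex_d (P : ModuleCat.{u} R) {i j : ℤ} (h : i + 1 = j) :
    (biprodSelfComplex P).d i j = biprodShift P := if_pos h

lemma isTotallyAcyclic_biprodSelfComplex (P : ModuleCat.{u} R) [Projective P] :
    IsTotallyAcyclic R (biprodSelfComplex P) where
  projective i := inferInstanceAs (Projective (P ⊞ P))
  acyclic i := by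
    rw [HomologicalComplex.exactAt_iff' _ (i - 1) i (i + 1) (by simp) (by simp),
      ShortComplex.exact_iff_exact_up_to_refinements]
    intro A k hk
    change A ⟶ P ⊞ P at k
    change k ≫ (biprodSelfComplex P).d i (i + 1) = 0 at hk
    rw [biprodSelfComplex_d P rfl] at hk
    refine ⟨A, 𝟙 A, inferInstance, k ≫ biprod.fst ≫ biprod.inr, ?_⟩
    change 𝟙 A ≫ k = (k ≫ biprod.fst ≫ biprod.inr) ≫ (biprodSelfComplex P).d (i - 1) i
    rw [biprodSelfComplex_d P (by ring), Category.id_comp]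
    exact eq_comp_biprodShift k hk
  hom_exact Q _ i f hf := by
    rw [biprodSelfComplex_d P (by ring)] at hf
    rw [biprodSelfComplex_d P rfl]
    exact ⟨_, (eq_biprodShift_comp f hf).symm⟩

/-- The second projection is a cokernel of `biprodShift P`. -/
noncomputable def biprodShiftIsCokernel (P : ModuleCat.{u} R) {f : P ⊞ P ⟶ P ⊞ P}
    (hf : f = biprodShift P) :
    IsColimit (CokernelCofork.ofπ (f := f) (biprod.snd : P ⊞ P ⟶ P)
      (by simp [hf, biprodShift])) := by
  refine CokernelCofork.IsColimit.ofπ _ _ (fun k _ => biprod.inr ≫ k)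
    (fun k hk => ?_) (fun k hk m hm => ?_)
  · have h : biprod.inl ≫ k = 0 := by
      simpa [hf, biprodShift] using congrArg (fun t => biprod.inr ≫ t) hk
    apply biprod.hom_ext' <;> simp [h]
  · simp [← hm]

/-- A complex with the same term and differential in every degree spares the case distinction on
degrees that the two-term complex `P = P` would need. -/
lemma isGorensteinProjective_of_projective (P : ModuleCat.{u} R) [Projective P] :
    IsGorensteinProjective R P :=
  ⟨_, isTotallyAcyclic_biprodSelfComplex P,
    ⟨(biprodShiftIsCokernel P (biprodSelfComplex_d P (by simp))).coconePointUniqueUpToIso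
      ((biprodSelfComplex P).opcyclesIsCokernel (-1) 0 (by simp))⟩⟩

variable [HasDerivedCategory.{w} (ModuleCat.{u} R)]

open DerivedCategory

/-- For `n < 0` such a map is a class in `Ext^(-n)(G, M)`, which vanishes; for `n > 0` the source
lies in negative degrees and the t-structure excludes nonzero maps. -/
lemma eq_zero_of_shift_ne_zero {G M : ModuleCat.{u} R} (hG : IsGorensteinProjective R G)
    (d : ℕ) [HasProjectiveDimensionLT M (d + 1)] (n : ℤ) (hn : n ≠ 0)
    (g : ((singleFunctor (ModuleCat.{u} R) 0).obj G)⟦n⟧ ⟶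
      (singleFunctor (ModuleCat.{u} R) 0).obj M) : g = 0 := by
  rcases lt_or_gt_of_ne hn with hn | hn
  · obtain ⟨k, rfl⟩ : ∃ k : ℕ, n = -((k + 1 : ℕ) : ℤ) := ⟨(-n - 1).toNat, by lia⟩
    have h (f : (singleFunctor (ModuleCat.{u} R) 0).obj G ⟶
        ((singleFunctor (ModuleCat.{u} R) 0).obj M)⟦((k + 1 : ℕ) : ℤ)⟧) : f = 0 := by
      obtain ⟨α, rfl⟩ := Ext.homEquiv.surjective f
      rw [hG.ext_eq_zero d M k α]
      exact Ext.zero_hom _ _ _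
    exact ((shiftEquiv (DerivedCategory (ModuleCat.{u} R))
      ((k + 1 : ℕ) : ℤ)).symm.toAdjunction.homEquiv _ _).injective ((h _).trans (h _).symm)
  · have := TStructure.t.isLE_shift ((singleFunctor (ModuleCat.{u} R) 0).obj G) 0 n (-n)
    exact TStructure.t.zero_of_isLE_of_isGE g (-n) 0 (by lia) this inferInstance

/-- The connecting morphism of a short exact sequence `0 ⟶ Ω ⟶ P ⟶ M ⟶ 0` of modules of finite
projective dimension is ghost. -/
lemma triangEnvelopeIter_zero_le_annihilatedBy_singleδ {S : ShortComplex (ModuleCat.{u} R)}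
    (hS : S.ShortExact) (d : ℕ) (h₁ : HasProjectiveDimensionLT S.X₁ (d + 1))
    (h₃ : HasProjectiveDimensionLT S.X₃ (d + 1)) :
    (gorensteinProjectives R).triangEnvelopeIter 0 ≤ annihilatedBy hS.singleδ := by
  refine triangEnvelopeIter_zero_le_annihilatedBy _ ?_
  rintro X ⟨G, -, hG, ⟨e⟩⟩ n g
  have key (g : ((singleFunctor (ModuleCat.{u} R) 0).obj G)⟦n⟧ ⟶
      (singleFunctor (ModuleCat.{u} R) 0).obj S.X₃) : g ≫ hS.singleδ = 0 := by
    by_cases hn : n = 0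
    · subst hn
      let e₀ := (shiftFunctorZero (DerivedCategory (ModuleCat.{u} R)) ℤ).app
        ((singleFunctor (ModuleCat.{u} R) 0).obj G)
      -- In degree zero `g` comes from a module map `f`, and its composite with the connecting
      -- morphism is a class in `Ext¹(G, S.X₁) = 0`.
      obtain ⟨f, hf⟩ := (singleFunctor (ModuleCat.{u} R) 0).map_surjective (e₀.inv ≫ g)
      have h := congrArg Ext.hom (hG.ext_eq_zero d S.X₁ 0
        ((Ext.mk₀ f).comp hS.extClass (zero_add 1)))
      rw [← Ext.singleFunctor_map_comp_hom, hf, hS.extClass_hom, Ext.zero_hom] at h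
      have h' := congrArg (fun t => e₀.hom ≫ t) h
      simpa using h'
    · rw [eq_zero_of_shift_ne_zero hG d n hn g, zero_comp]
  have h := key ((shiftFunctor _ n).map e.inv ≫ g)
  have h' := congrArg (fun t => (shiftFunctor _ n).map e.hom ≫ t) h
  simpa [← Functor.map_comp_assoc] using h'

end GorensteinProjective

/-! ### Levels of modules of finite projective dimension -/

section ProjectiveDimension

open Abelian DerivedCategory

variable {R : Type u} [CommRing R]

/-- If the class vanished, the identity of `S.X₃` would lift along `S.g`, making `S.X₃` a retract of
a projective. -/
lemma extClass_ne_zero_of_not_projective {S : ShortComplex (ModuleCat.{u} R)} (hS : S.ShortExact)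
    (hP : Projective S.X₂) (h : ¬ Projective S.X₃) : hS.extClass ≠ 0 := by
  intro h0
  obtain ⟨x, hx⟩ := Ext.covariant_sequence_exact₃ S.X₃ hS (Ext.mk₀ (𝟙 S.X₃)) (zero_add 1)
    (by rw [h0, Ext.comp_zero])
  obtain ⟨f, rfl⟩ := (Ext.mk₀_bijective _ _).2 x
  rw [Ext.mk₀_comp_mk₀, (Ext.mk₀_bijective _ _).1.eq_iff] at hx
  exact h (Retract.mk f S.g hx).projective

lemma exists_shortExact_projective_finite [IsNoetherianRing R] (M : ModuleCat.{u} R)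
    [Module.Finite R M] :
    ∃ S : ShortComplex (ModuleCat.{u} R), S.ShortExact ∧ Projective S.X₂ ∧
      Module.Finite R S.X₂ ∧ Module.Finite R S.X₁ ∧ S.X₃ = M := by
  obtain ⟨_, _, _, _, _, f, hf⟩ := Module.exists_finite_presentation R M
  exact ⟨f.shortComplexKer, LinearMap.shortExact_shortComplexKer hf, inferInstance, ‹_›,
    inferInstance, rfl⟩

variable [HasDerivedCategory.{w} (ModuleCat.{u} R)]

/-- A module of finite projective dimension greater than `d` has an extension class of degree
`d + 1` which is a composition of `d + 1` ghost morphisms. -/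
lemma exists_ext_ne_zero_annihilates (d k : ℕ) (M : ModuleCat.{u} R)
    [HasProjectiveDimensionLT M (k + 1)] (hM : ¬ HasProjectiveDimensionLT M (d + 1)) :
    ∃ (N : ModuleCat.{u} R) (α : Ext M N (d + 1)), α ≠ 0 ∧
      (gorensteinProjectives R).triangEnvelopeIter d ≤ annihilatedBy α.hom := by
  induction d generalizing M with
  | zero =>
    obtain ⟨S, hS, hP, rfl⟩ := exists_shortExact_projective M
    have h₁ := hS.hasProjectiveDimensionLT_X₁ (k + 1) inferInstance inferInstance
    refine ⟨S.X₁, hS.extClass, extClass_ne_zero_of_not_projective hS hP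
      (fun h => hM (projective_iff_hasProjectiveDimensionLT_one.mp h)), ?_⟩
    rw [hS.extClass_hom]
    exact triangEnvelopeIter_zero_le_annihilatedBy_singleδ hS k h₁ ‹_›
  | succ d ih =>
    obtain ⟨S, hS, hP, rfl⟩ := exists_shortExact_projective M
    have h₁ := hS.hasProjectiveDimensionLT_X₁ (k + 1) inferInstance inferInstance
    obtain ⟨N, β, hβ, hβ'⟩ := ih S.X₁
      (fun h => hM ((hS.hasProjectiveDimensionLT_X₃_iff d hP).mpr h))
    refine ⟨N, hS.extClass.comp β (by lia), fun h0 => hβ ?_, ?_⟩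
    -- If the product vanished, `β` would extend to a positive-degree class on the projective
    -- `S.X₂`, hence be zero.
    · obtain ⟨x, rfl⟩ := Ext.contravariant_sequence_exact₁ hS N β (by lia) h0
      rw [Ext.eq_zero_of_projective x, Ext.comp_zero]
    · rw [Ext.comp_hom, hS.extClass_hom, ShiftedHom.comp]
      exact triangEnvelopeIter_succ_le_annihilatedBy _ _
        (triangEnvelopeIter_zero_le_annihilatedBy_singleδ hS k h₁ ‹_›)
        ((triangEnvelopeIter_le_annihilatedBy_shift _ hβ' _).trans (annihilatedBy_le_comp _ _))

lemma not_triangEnvelopeIter_singleFunctor (d k : ℕ) (M : ModuleCat.{u} R)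
    [HasProjectiveDimensionLT M (k + 1)] (hM : ¬ HasProjectiveDimensionLT M (d + 1)) :
    ¬ (gorensteinProjectives R).triangEnvelopeIter d
      ((singleFunctor (ModuleCat.{u} R) 0).obj M) := by
  intro h
  obtain ⟨N, α, hα, hα'⟩ := exists_ext_ne_zero_annihilates d k M hM
  refine hα (Ext.ext ?_)
  rw [Ext.zero_hom]
  simpa using hα' _ h (𝟙 _)

lemma triangEnvelopeIter_singleFunctor [IsNoetherianRing R] (d : ℕ) (M : ModuleCat.{u} R)
    [Module.Finite R M] [HasProjectiveDimensionLT M (d + 1)] :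
    (gorensteinProjectives R).triangEnvelopeIter d
      ((singleFunctor (ModuleCat.{u} R) 0).obj M) := by
  induction d generalizing M with
  | zero =>
    have : Projective M := projective_iff_hasProjectiveDimensionLT_one.mpr ‹_›
    exact ObjectProperty.le_triangEnvelopeIter _ _ _
      ⟨M, ‹_›, isGorensteinProjective_of_projective M, ⟨Iso.refl _⟩⟩
  | succ d ih =>
    obtain ⟨S, hS, hP, hfin₂, hfin₁, rfl⟩ := exists_shortExact_projective_finite M
    have := (hS.hasProjectiveDimensionLT_X₃_iff d hP).mp ‹_›
    rw [ObjectProperty.triangEnvelopeIter_succ, ← ObjectProperty.triangEnvelopeIter_zero]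
    -- The rotated triangle `S.X₂ ⟶ S.X₃ ⟶ S.X₁⟦1⟧` has the projective first, and the envelope of
    -- the syzygy is stable under shifts.
    refine ObjectProperty.le_retractClosure _ _
      ⟨_, _, _, _, _, Pretriangulated.rot_of_distTriang _ hS.singleTriangle_distinguished, ?_, ?_⟩
    · exact ObjectProperty.le_triangEnvelopeIter _ _ _
        ⟨S.X₂, hfin₂, isGorensteinProjective_of_projective _, ⟨Iso.refl _⟩⟩
    · exact ObjectProperty.le_shift _ (1 : ℤ) _ (ih S.X₁)

/-- The G-level of a finitely generated module of finite projective dimension `d` is `d + 1`. -/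
lemma level_singleFunctor_eq [IsNoetherianRing R] (d : ℕ) (M : ModuleCat.{u} R)
    [Module.Finite R M] [HasProjectiveDimensionLT M (d + 1)]
    (hM : ¬ HasProjectiveDimensionLT M d) :
    level (gorensteinProjectives R) ((singleFunctor (ModuleCat.{u} R) 0).obj M) = d + 1 := by
  refine le_antisymm (level_le_of_triangEnvelopeIter (triangEnvelopeIter_singleFunctor d M)) ?_
  have h0 : ¬ IsZero ((singleFunctor (ModuleCat.{u} R) 0).obj M) := by
    intro h
    have hz : IsZero M := by
      rw [IsZero.iff_id_eq_zero] at h ⊢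
      apply (singleFunctor (ModuleCat.{u} R) 0).map_injective
      simpa using h
    have := hz.hasProjectiveDimensionLT_zero
    exact hM (hasProjectiveDimensionLT_of_ge M 0 d (Nat.zero_le d))
  cases d with
  | zero => simpa using one_le_level h0
  | succ d =>
    exact_mod_cast le_level_of_not_triangEnvelopeIter h0
      (not_triangEnvelopeIter_singleFunctor d (d + 1) M hM)

end ProjectiveDimension

/-! ### Koszul complexes on regular sequences -/

section Koszul

open Abelian DerivedCategory RingTheory.Sequence Pointwise

variable {R : Type u} [CommRing R]

lemma isBoundedFiniteFree_koszulComplex (rs : List R) :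
    IsBoundedFiniteFree R (koszulComplex R rs) := by
  induction rs with
  | nil =>
    have hz (i : ℤ) (hi : i ≠ 0) : IsZero ((koszulComplex R []).X i) :=
      HomologicalComplex.isZero_single_obj_X _ _ _ _ hi
    have e : (koszulComplex R []).X 0 ≅ ModuleCat.of R R :=
      HomologicalComplex.singleObjXSelf (ComplexShape.up ℤ) 0 (ModuleCat.of R R)
    refine ⟨⟨0, 0, fun i hi => hz i (by lia)⟩, fun i => ?_, fun i => ?_⟩ <;>
      rcases eq_or_ne i 0 with rfl | hi
    · exact Module.Finite.equiv e.toLinearEquiv.symm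
    · have := ModuleCat.subsingleton_of_isZero (hz i hi)
      infer_instance
    · exact Module.Free.of_equiv e.toLinearEquiv.symm
    · have := ModuleCat.subsingleton_of_isZero (hz i hi)
      infer_instance
  | cons x xs ih =>
    obtain ⟨⟨a, b, hab⟩, hfin, hfree⟩ := ih
    let e (i : ℤ) : (koszulComplex R (x :: xs)).X i ≅
        (koszulComplex R xs).X (i + 1) ⊞ (koszulComplex R xs).X i :=
      HomologicalComplex.homotopyCofiber.XIsoBiprod (x • 𝟙 (koszulComplex R xs)) i (i + 1) rfl
    let e' (i : ℤ) := (e i ≪≫ ModuleCat.biprodIsoProd _ _).toLinearEquiv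
    refine ⟨⟨a - 1, b, fun i hi => ?_⟩, fun i => ?_, fun i => ?_⟩
    · refine IsZero.of_iso ?_ (e i)
      exact (biprod_isZero_iff _ _).mpr ⟨hab _ (by lia), hab _ (by lia)⟩
    · have := hfin i
      have := hfin (i + 1)
      exact Module.Finite.equiv (e' i).symm
    · have := hfree i
      have := hfree (i + 1)
      exact Module.Free.of_equiv (e' i).symm

/-- The quotient of `R` by the ideal generated by a sequence, as a module. -/
abbrev quotientOfList (rs : List R) : ModuleCat.{u} R :=
  ModuleCat.of R (R ⧸ (Ideal.ofList rs • ⊤ : Submodule R R))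

lemma ofList_reverse (rs : List R) : Ideal.ofList rs.reverse = Ideal.ofList rs := by
  simp [Ideal.ofList]

variable (R) in
/-- The quotient by the empty sequence is `R`. -/
noncomputable def quotientOfListNilIso : ModuleCat.of R R ≅ quotientOfList ([] : List R) :=
  (Submodule.quotEquivOfEqBot _ (by rw [Ideal.ofList_nil, Submodule.bot_smul])).symm.toModuleIso

/-- The isomorphism `R / (x, xs) ≅ (R / xs) / x`. -/
noncomputable def quotientOfListConsIso (x : R) (xs : List R) :
    ((quotientOfList xs).smulShortComplex x).X₃ ≅ quotientOfList (x :: xs) :=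
  (Submodule.quotOfListConsSMulTopEquivQuotSMulTopOuter R x xs).symm.toModuleIso

/-- The Koszul complex takes the cone for the head `x` last, so `x` must be regular modulo `xs`.
This is why regularity is imposed on the reversed list throughout. -/
lemma isSMulRegular_of_isWeaklyRegular_reverse_cons {x : R} {xs : List R}
    (h : IsWeaklyRegular R (x :: xs).reverse) :
    IsWeaklyRegular R xs.reverse ∧ IsSMulRegular (quotientOfList xs) x := by
  rw [List.reverse_cons, isWeaklyRegular_append_iff, isWeaklyRegular_singleton_iff,
    ofList_reverse] at h
  exact h

lemma hasProjectiveDimensionLT_quotientOfList {rs : List R}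
    (h : IsWeaklyRegular R rs.reverse) :
    HasProjectiveDimensionLT (quotientOfList rs) (rs.length + 1) := by
  induction rs with
  | nil =>
    have : HasProjectiveDimensionLT (ModuleCat.of R R) 1 := inferInstance
    exact hasProjectiveDimensionLT_of_iso (quotientOfListNilIso R) 1
  | cons x xs ih =>
    obtain ⟨h₁, h₂⟩ := isSMulRegular_of_isWeaklyRegular_reverse_cons h
    have := ih h₁
    have := h₂.smulShortComplex_shortExact.hasProjectiveDimensionLT_X₃ (xs.length + 1)
      (ih h₁) (hasProjectiveDimensionLT_of_ge (quotientOfList xs) (xs.length + 1) _ (by simp))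
    exact hasProjectiveDimensionLT_of_iso (quotientOfListConsIso x xs) _

lemma ext_mk₀_smul_id_comp_eq_zero {M N : ModuleCat.{u} R} {x : R}
    (hx : x ∈ Module.annihilator R N) {n : ℕ} (δ : Ext M N n) :
    (Ext.mk₀ (x • 𝟙 M)).comp δ (zero_add n) = 0 := by
  have hx' : x • 𝟙 N = 0 := by
    ext y
    exact Module.mem_annihilator.mp hx y
  rw [Ext.mk₀_smul, Ext.smul_comp, Ext.mk₀_id_comp, Ext.smul_eq_comp_mk₀, hx', Ext.mk₀_zero,
    Ext.comp_zero]

/-- Multiplication by `x` on `R / xs` acts on Ext into `N` as multiplication by `x` on `N`, that is,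
as zero. So the connecting map to Ext of `R / (x, xs)` in the next degree is injective, and a
nonzero map `R ⟶ N` starts the induction. -/
lemma exists_ext_quotientOfList_ne_zero {rs : List R} (h : IsWeaklyRegular R rs.reverse)
    (N : ModuleCat.{u} R) [Nontrivial N] (hN : ∀ r ∈ rs, r ∈ Module.annihilator R N) :
    ∃ α : Ext (quotientOfList rs) N rs.length, α ≠ 0 := by
  induction rs with
  | nil =>
    obtain ⟨y, hy⟩ := exists_ne (0 : N)
    refine ⟨Ext.mk₀ ((quotientOfListNilIso R).inv ≫ ModuleCat.ofHom (LinearMap.toSpanSingleton R N y)), ?_⟩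
    rw [Ne, Ext.mk₀_eq_zero_iff]
    intro h0
    have h1 : ModuleCat.ofHom (LinearMap.toSpanSingleton R N y) = 0 := by
      simpa using congrArg (fun t => (quotientOfListNilIso R).hom ≫ t) h0
    apply hy
    simpa using congrArg (fun t : ModuleCat.of R R ⟶ N => t.hom (1 : R)) h1
  | cons x xs ih =>
    obtain ⟨h₁, h₂⟩ := isSMulRegular_of_isWeaklyRegular_reverse_cons h
    obtain ⟨β, hβ⟩ := ih h₁ (fun r hr => hN r (List.mem_cons_of_mem _ hr))
    have hS := h₂.smulShortComplex_shortExact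
    let γ : Ext ((quotientOfList xs).smulShortComplex x).X₃ N (xs.length + 1) :=
      hS.extClass.comp β (by lia)
    have hγ : γ ≠ 0 := by
      intro h0
      obtain ⟨δ, rfl⟩ := Ext.contravariant_sequence_exact₁ hS N β (by lia) h0
      exact hβ (ext_mk₀_smul_id_comp_eq_zero (hN x List.mem_cons_self) δ)
    refine ⟨(Ext.mk₀ (quotientOfListConsIso x xs).inv).comp γ (zero_add _), fun h0 => hγ ?_⟩
    simpa using congrArg
      (fun t => (Ext.mk₀ (quotientOfListConsIso x xs).hom).comp t (zero_add _)) h0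

lemma not_hasProjectiveDimensionLT_quotientOfList {rs : List R}
    (h : IsWeaklyRegular R rs.reverse) {m : Ideal R} (hm : m ≠ ⊤) (hrs : ∀ r ∈ rs, r ∈ m) :
    ¬ HasProjectiveDimensionLT (quotientOfList rs) rs.length := by
  intro hpd
  have : Nontrivial (R ⧸ m) := Ideal.Quotient.nontrivial_iff.mpr hm
  obtain ⟨α, hα⟩ := exists_ext_quotientOfList_ne_zero h (ModuleCat.of R (R ⧸ m))
    (fun r hr => by rw [Ideal.annihilator_quotient]; exact hrs r hr)
  exact hα (α.eq_zero_of_hasProjectiveDimensionLT rs.length le_rfl)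

variable [HasDerivedCategory.{w} (ModuleCat.{u} R)]

open Pretriangulated

/-- The Koszul complex on a regular sequence is a resolution of the quotient. -/
lemma nonempty_Q_koszulComplex_iso {rs : List R} (h : IsWeaklyRegular R rs.reverse) :
    Nonempty (Q.obj (koszulComplex R rs) ≅
      (singleFunctor (ModuleCat.{u} R) 0).obj (quotientOfList rs)) := by
  induction rs with
  | nil =>
    exact ⟨((singleFunctorIsoCompQ (ModuleCat.{u} R) 0).app _).symm ≪≫
      (singleFunctor (ModuleCat.{u} R) 0).mapIso (quotientOfListNilIso R)⟩
  | cons x xs ih =>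
    obtain ⟨h₁, h₂⟩ := isSMulRegular_of_isWeaklyRegular_reverse_cons h
    obtain ⟨e⟩ := ih h₁
    have hS := h₂.smulShortComplex_shortExact
    let T := Q.mapTriangle.obj
      (CochainComplex.mappingCone.triangle (x • 𝟙 (koszulComplex R xs)))
    have hT : T ∈ distTriang _ := mappingCone_triangle_distinguished _
    have hcomm : Q.map (x • 𝟙 (koszulComplex R xs)) ≫ e.hom =
        e.hom ≫ (singleFunctor (ModuleCat.{u} R) 0).map (x • 𝟙 (quotientOfList xs)) := by
      rw [Functor.map_smul, Functor.map_smul,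
        CategoryTheory.Functor.map_id, CategoryTheory.Functor.map_id]
      simp
    -- Both triangles complete multiplication by `x`, so their third terms, the Koszul complex and
    -- `(R / xs) / x`, are isomorphic.
    let E := isoTriangleOfIso₁₂ T hS.singleTriangle hT hS.singleTriangle_distinguished e e hcomm
    exact ⟨(Triangle.π₃.mapIso E : _) ≪≫
      (singleFunctor (ModuleCat.{u} R) 0).mapIso (quotientOfListConsIso x xs)⟩

/-- The G-level of the Koszul complex on a regular sequence of length `d` is `d + 1`. -/
lemma gLevel_koszulComplex [IsNoetherianRing R] {rs : List R}
    (h : IsWeaklyRegular R rs.reverse) {m : Ideal R} (hm : m ≠ ⊤) (hrs : ∀ r ∈ rs, r ∈ m) :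
    gLevel.{w} R (koszulComplex R rs) = rs.length + 1 := by
  obtain ⟨e⟩ := nonempty_Q_koszulComplex_iso.{w} h
  have := hasProjectiveDimensionLT_quotientOfList h
  rw [gLevel, level_eq_of_iso _ e]
  exact level_singleFunctor_eq _ _ (not_hasProjectiveDimensionLT_quotientOfList h hm hrs)

end Koszul

/-! ### Depth and regular sequences in Cohen–Macaulay rings -/

section CohenMacaulay

open Abelian RingTheory.Sequence Pointwise IsLocalRing

/-- By the long exact sequence, dividing by a regular element costs one degree of Ext vanishing. -/
lemma subsingleton_ext_quotSMulTop {R : Type u} [CommRing R] {M N : ModuleCat.{u} R} {x : R}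
    (hx : IsSMulRegular M x) {n : ℕ} (h : ∀ i < n + 1, Subsingleton (Ext N M i)) (i : ℕ)
    (hi : i < n) : Subsingleton (Ext N (M.smulShortComplex x).X₃ i) := by
  refine subsingleton_of_forall_eq 0 fun α => ?_
  have hS := hx.smulShortComplex_shortExact
  have h₁ := h (i + 1) (by lia)
  have h₂ := h i (by lia)
  obtain ⟨y, rfl⟩ := Ext.covariant_sequence_exact₃ N hS α rfl (h₁.elim _ _)
  rw [show y = 0 from h₂.elim _ _, Ext.zero_comp]

lemma subsingleton_ext_of_iso {R : Type u} [CommRing R] {N M M' : ModuleCat.{u} R} (e : M ≅ M')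
    {i : ℕ} (h : Subsingleton (Ext N M i)) : Subsingleton (Ext N M' i) := by
  refine subsingleton_of_forall_eq 0 fun α => ?_
  have h0 : α.comp (Ext.mk₀ e.inv) (add_zero i) = 0 := h.elim _ _
  simpa using congrArg (fun t => t.comp (Ext.mk₀ e.hom) (add_zero i)) h0

lemma subsingleton_ext_quotientOfList {R : Type u} [CommRing R] {rs : List R}
    (hrs : IsWeaklyRegular R rs.reverse) (N : ModuleCat.{u} R) (n : ℕ)
    (h : ∀ i < n + rs.length, Subsingleton (Ext N (ModuleCat.of R R) i)) :
    ∀ i < n, Subsingleton (Ext N (quotientOfList rs) i) := by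
  induction rs generalizing n with
  | nil => exact fun i hi => subsingleton_ext_of_iso (quotientOfListNilIso R) (h i hi)
  | cons x xs ih =>
    obtain ⟨h₁, h₂⟩ := isSMulRegular_of_isWeaklyRegular_reverse_cons hrs
    intro i hi
    refine subsingleton_ext_of_iso (quotientOfListConsIso x xs)
      (subsingleton_ext_quotSMulTop h₂ (ih h₁ (n + 1) fun j hj => h j ?_) i hi)
    rw [List.length_cons]
    lia

/-- A linear map out of `R ⧸ I` is determined by the image of `1`, which can be any class killed by
`I`. -/
lemma subsingleton_linearMap_quotient_iff {R : Type*} [CommRing R] (I J : Ideal R) :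
    Subsingleton ((R ⧸ I) →ₗ[R] (R ⧸ J)) ↔ ∀ a : R, (∀ x ∈ I, x * a ∈ J) → a ∈ J := by
  constructor
  · intro h a ha
    let f : (R ⧸ I) →ₗ[R] (R ⧸ J) := Submodule.liftQ I (LinearMap.toSpanSingleton R _
      (Ideal.Quotient.mk J a)) fun x hx => by
        rw [LinearMap.mem_ker, LinearMap.toSpanSingleton_apply, Algebra.smul_def]
        exact Ideal.Quotient.eq_zero_iff_mem.mpr (ha x hx)
    have h1 : f (Ideal.Quotient.mk I 1) = 0 := by rw [h.elim f 0, LinearMap.zero_apply]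
    have h2 : f (Ideal.Quotient.mk I 1) = (1 : R) • Ideal.Quotient.mk J a := rfl
    rwa [h2, one_smul, Ideal.Quotient.eq_zero_iff_mem] at h1
  · intro h
    refine subsingleton_of_forall_eq 0 fun f => ?_
    obtain ⟨a, ha⟩ := Ideal.Quotient.mk_surjective (f 1)
    have haJ : a ∈ J := h a fun x hx => by
      rw [← Ideal.Quotient.eq_zero_iff_mem, map_mul, ha]
      change x • f 1 = 0
      rw [← map_smul, Algebra.smul_def, mul_one]
      exact (congrArg f (Ideal.Quotient.eq_zero_iff_mem.mpr hx)).trans (map_zero f)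
    have h1 : f 1 = 0 := by rw [← ha, Ideal.Quotient.eq_zero_iff_mem.mpr haJ]
    ext
    simpa using h1

lemma exists_isRegular_of_le_localDepth {R : Type u} [CommRing R] [IsLocalRing R] {d : ℕ}
    (h : (d : ℕ∞) ≤ localDepth R) :
    ∃ rs : List R, d ≤ rs.length ∧ (∀ r ∈ rs, r ∈ maximalIdeal R) ∧ IsRegular R rs := by
  cases d with
  | zero => exact ⟨[], le_rfl, by simp, IsRegular.nil R R⟩
  | succ d =>
    have h' : (d : ℕ∞) < localDepth R := lt_of_lt_of_le (by exact_mod_cast d.lt_succ_self) h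
    simp only [localDepth, lt_iSup_iff] at h'
    obtain ⟨rs, ⟨h₁, h₂⟩, h₃⟩ := h'
    exact ⟨rs, by exact_mod_cast h₃, h₁, h₂⟩

/-- If the depth of a local ring exceeds the length of a regular sequence, then the maximal ideal
is not associated to the quotient by this sequence. -/
lemma mem_of_forall_mul_mem_of_lt_localDepth {A : Type u} [CommRing A] [IsNoetherianRing A]
    [IsLocalRing A] {d : ℕ} (hd : (d : ℕ∞) ≤ localDepth A) {xs : List A}
    (hxs : IsWeaklyRegular A xs.reverse) (hlen : xs.length < d) (a : A)
    (ha : ∀ x ∈ maximalIdeal A, x * a ∈ Ideal.ofList xs) : a ∈ Ideal.ofList xs := by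
  obtain ⟨ys, hys, hmem, hreg⟩ := exists_isRegular_of_le_localDepth hd
  have hext := ModuleCat.subsingleton_ext_of_exists_isRegular (maximalIdeal A)
    (ModuleCat.of A (A ⧸ maximalIdeal A))
    (by rw [Module.support_eq_zeroLocus, Ideal.annihilator_quotient]) (ModuleCat.of A A)
    (by simpa [Ideal.mul_top, lt_top_iff_ne_top] using Ideal.IsPrime.ne_top inferInstance)
    ys hmem hreg
  -- The sequence `ys` makes Ext of the residue field into `A` vanish below degree `d`. Passing to
  -- `A / xs` loses `xs.length < d` degrees, so degree zero still vanishes.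
  have h0 := subsingleton_ext_quotientOfList hxs _ 1 (fun i hi => hext i (by lia)) 0 one_pos
  have h3 : Subsingleton (ModuleCat.of A (A ⧸ maximalIdeal A) ⟶ quotientOfList xs) :=
    Ext.addEquiv₀.symm.subsingleton
  have h1 : Subsingleton ((A ⧸ maximalIdeal A) →ₗ[A]
      (A ⧸ (Ideal.ofList xs • ⊤ : Submodule A A))) :=
    (ModuleCat.homAddEquiv (M := ModuleCat.of A (A ⧸ maximalIdeal A))
      (N := quotientOfList xs)).symm.subsingleton
  have h2 := (subsingleton_linearMap_quotient_iff _ _).mp h1 a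
  simp only [smul_eq_mul, Ideal.mul_top] at h2
  exact h2 ha

/-- A maximal ideal contains a weakly regular sequence of any length up to the depth of the
localization. -/
lemma exists_isWeaklyRegular_of_le_localDepth {R : Type u} [CommRing R] [IsNoetherianRing R]
    (m : Ideal R) [m.IsMaximal] {d : ℕ} (hd : (d : ℕ∞) ≤ localDepth (Localization.AtPrime m))
    (n : ℕ) (hn : n ≤ d) :
    ∃ xs : List R, xs.length = n ∧ (∀ x ∈ xs, x ∈ m) ∧ IsWeaklyRegular R xs.reverse := by
  induction n with
  | zero => exact ⟨[], rfl, by simp, by simp⟩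
  | succ n ih =>
    obtain ⟨xs, hlen, hmem, hreg⟩ := ih (by lia)
    let A := Localization.AtPrime m
    have hA : IsWeaklyRegular A (xs.map (algebraMap R A)).reverse := by
      rw [← List.map_reverse]
      exact hreg.of_isLocalization A m.primeCompl
    -- Vanishing of these homomorphisms gives an element of `m` regular on `R / xs`; it is checked
    -- after localizing at `m`.
    have hsub : Subsingleton ((R ⧸ m) →ₗ[R] quotientOfList xs) := by
      refine (subsingleton_linearMap_quotient_iff _ _).mpr fun a ha => ?_
      rw [smul_eq_mul, Ideal.mul_top] at ha ⊢
      have h1 : algebraMap R A a ∈ (Ideal.ofList xs).map (algebraMap R A) := by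
        rw [Ideal.map_ofList]
        refine mem_of_forall_mul_mem_of_lt_localDepth hd hA (by simpa [hlen] using hn) _ ?_
        intro x hx
        rw [← Localization.AtPrime.map_eq_maximalIdeal] at hx
        rw [← Ideal.map_ofList]
        refine Submodule.span_induction (p := fun x _ => x * algebraMap R A a ∈
          (Ideal.ofList xs).map (algebraMap R A)) ?_ ?_ ?_ ?_ hx
        · rintro _ ⟨y, hy, rfl⟩
          rw [← map_mul]
          exact Ideal.mem_map_of_mem _ (ha y hy)
        · simp
        · intro y z _ _ hy hz
          rw [add_mul]
          exact add_mem hy hz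
        · intro r y _ hy
          rw [smul_eq_mul, mul_assoc]
          exact Ideal.mul_mem_left _ _ hy
      obtain ⟨s, hs, hsa⟩ :=
        (IsLocalization.algebraMap_mem_map_algebraMap_iff m.primeCompl A _ _).mp h1
      -- Here `s * a` lies in the ideal for some `s ∉ m`. Writing `1 = r * s + t` with `t ∈ m` puts
      -- `a` itself there, as `m` multiplies `a` into the ideal.
      obtain ⟨r, t, ht, hrt⟩ := Ideal.IsMaximal.exists_inv (I := m) ‹_› hs
      have : a = r * (s * a) + t * a := by rw [← mul_assoc, ← add_mul, hrt, one_mul]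
      rw [this]
      exact add_mem (Ideal.mul_mem_left _ _ hsa) (ha t ht)
    obtain ⟨x, hx, hxreg⟩ := IsSMulRegular.subsingleton_linearMap_iff.mp hsub
    rw [Ideal.annihilator_quotient] at hx
    refine ⟨x :: xs, by simp [hlen], by simpa [hx] using hmem, ?_⟩
    rw [List.reverse_cons, isWeaklyRegular_append_iff, isWeaklyRegular_singleton_iff,
      ofList_reverse]
    exact ⟨hreg, hxreg⟩

/-- In a Cohen–Macaulay ring a maximal ideal contains a weakly regular sequence whose length is
the height of the ideal. -/
lemma IsCohenMacaulay.exists_isWeaklyRegular {R : Type u} [CommRing R] [IsNoetherianRing R]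
    (hCM : IsCohenMacaulay R) (m : Ideal R) [m.IsMaximal] {d : ℕ} (hd : m.height = d) :
    ∃ xs : List R, xs.length = d ∧ (∀ x ∈ xs, x ∈ m) ∧ IsWeaklyRegular R xs.reverse := by
  have h := hCM m
  rw [IsLocalization.AtPrime.ringKrullDim_eq_height m, hd] at h
  exact exists_isWeaklyRegular_of_le_localDepth m (WithBot.coe_injective h).ge d le_rfl

/-! ### Dimension theory and sequences of parameters -/

section Dimension

variable {R : Type u} [CommRing R] [IsNoetherianRing R] [IsLocalRing R]

/-- An associated prime of `M` and an `M`-regular element lie in an associated prime of `M / x`. -/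
lemma exists_associatedPrime_quotSMulTop {M : Type*} [AddCommGroup M] [Module R M]
    [Module.Finite R M] {x : R} (hx : IsSMulRegular M x) (hxm : x ∈ maximalIdeal R) {p : Ideal R}
    (hp : p ∈ associatedPrimes R M) :
    ∃ q ∈ associatedPrimes R (QuotSMulTop x M), p ≤ q ∧ x ∈ q := by
  obtain ⟨hprime, z, rfl⟩ := isAssociatedPrime_iff.mp hp
  set p := (⊥ : Submodule R M).colon {z} with hpdef
  let N : Submodule R M := Submodule.torsionBySet R M p
  have hzN : z ∈ N := by
    rw [Submodule.mem_torsionBySet_iff]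
    rintro ⟨a, ha⟩
    exact (Submodule.mem_bot R).mp (Submodule.mem_colon_singleton.mp ha)
  have hz : z ≠ 0 := by
    rintro rfl
    exact hprime.ne_top (by simp [hpdef])
  -- If `N`, the elements killed by `p`, were inside `xM`, regularity of `x` would give `N = xN`,
  -- and Nakayama `N = 0`, although `z ∈ N`. So some `w ∈ N` has a nonzero class in `M / x`, killed
  -- by `p` and by `x`.
  have hN : ¬ N ≤ x • (⊤ : Submodule R M) := by
    intro hle
    have hle' : N ≤ Ideal.span {x} • N := by
      intro w hw
      obtain ⟨w', -, rfl⟩ := hle hw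
      rw [Submodule.ideal_span_singleton_smul]
      refine Submodule.smul_mem_pointwise_smul w' x N ?_
      rw [Submodule.mem_torsionBySet_iff] at hw ⊢
      intro a
      have h : (a : R) • x • w' = 0 := hw a
      refine hx (show x • (a : R) • w' = x • 0 from ?_)
      rw [smul_comm, h, smul_zero]
    have hbot := Submodule.eq_bot_of_le_smul_of_le_jacobson_bot (Ideal.span {x}) N
      (IsNoetherian.noetherian N) hle' (by
        rw [IsLocalRing.jacobson_eq_maximalIdeal _ bot_ne_top, Ideal.span_singleton_le_iff_mem]
        exact hxm)
    exact hz ((Submodule.mem_bot R).mp (hbot ▸ hzN))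
  obtain ⟨w, hwN, hw⟩ := SetLike.not_le_iff_exists.mp hN
  obtain ⟨q, hq, hle⟩ := exists_le_isAssociatedPrime_of_isNoetherianRing R
    (Submodule.Quotient.mk w : QuotSMulTop x M)
    (fun h => hw ((Submodule.Quotient.mk_eq_zero _).mp h))
  refine ⟨q, hq, fun a ha => hle ?_, hle ?_⟩
  · rw [Submodule.mem_colon_singleton, Submodule.mem_bot, ← Submodule.Quotient.mk_smul,
      (Submodule.mem_torsionBySet_iff _ _).mp hwN ⟨a, ha⟩, Submodule.Quotient.mk_zero]
  · rw [Submodule.mem_colon_singleton, Submodule.mem_bot, ← Submodule.Quotient.mk_smul,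
      Submodule.Quotient.mk_eq_zero]
    exact Submodule.smul_mem_pointwise_smul w x ⊤ trivial

/-- The dimension of `R / p` for an associated prime `p` of `M` is at least the depth of `M`. -/
lemma length_le_ringKrullDim_quotient_of_mem_associatedPrimes (ys : List R) :
    ∀ {M : Type u} [AddCommGroup M] [Module R M] [Module.Finite R M]
    (_ : ∀ y ∈ ys, y ∈ maximalIdeal R) (_ : IsWeaklyRegular M ys) {p : Ideal R}
    (_ : p ∈ associatedPrimes R M), ((ys.length : ℕ∞) : WithBot ℕ∞) ≤ ringKrullDim (R ⧸ p) := by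
  induction ys with
  | nil =>
    intro M _ _ _ _ _ p hp
    have : p.IsPrime := hp.isPrime
    exact ringKrullDim_nonneg_of_nontrivial
  | cons y ys ih =>
    intro M _ _ _ hm hreg p hp
    have : p.IsPrime := hp.isPrime
    rw [isWeaklyRegular_cons_iff] at hreg
    obtain ⟨q, hq, hpq, hyq⟩ := exists_associatedPrime_quotSMulTop hreg.1
      (hm y List.mem_cons_self) hp
    have hyp : y ∉ p := by
      intro hy
      have : y ∈ ⋃ p ∈ associatedPrimes R M, (p : Set R) := Set.mem_iUnion₂_of_mem hp hy
      rw [biUnion_associatedPrimes_eq_compl_regular] at this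
      exact this hreg.1
    have h1 := ih (fun z hz => hm z (List.mem_cons_of_mem _ hz)) hreg.2 hq
    -- The regular element `y` avoids `p` but lies in `q`, so its image is a nonzerodivisor of the
    -- domain `R ⧸ p` and the dimension drops.
    have h2 : ringKrullDim (R ⧸ q) + 1 ≤ ringKrullDim (R ⧸ p) := by
      refine ringKrullDim_succ_le_of_surjective (Ideal.Quotient.factor hpq)
        (Ideal.Quotient.factor_surjective hpq) (r := Ideal.Quotient.mk p y) ?_ ?_
      · exact mem_nonZeroDivisors_of_ne_zero (fun h => hyp (Ideal.Quotient.eq_zero_iff_mem.mp h))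
      · simpa using Ideal.Quotient.eq_zero_iff_mem.mpr hyq
    refine le_trans ?_ h2
    rw [List.length_cons]
    push_cast
    gcongr
    exact_mod_cast h1

/-- Krull's height theorem for quotients by a prime ideal. -/
lemma ringKrullDim_quotient_le_length {p : Ideal R} [p.IsPrime] {rs : List R}
    (h : maximalIdeal R ≤ (p ⊔ Ideal.ofList rs).radical) (hrs : ∀ r ∈ rs, r ∈ maximalIdeal R) :
    ringKrullDim (R ⧸ p) ≤ ((rs.length : ℕ∞) : WithBot ℕ∞) := by
  classical
  let s : Finset (R ⧸ p) := (rs.map (Ideal.Quotient.mk p)).toFinset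
  have : IsLocalRing (R ⧸ p) := .of_surjective' _ Ideal.Quotient.mk_surjective
  have hmin : maximalIdeal (R ⧸ p) ∈ (Ideal.span (s : Set (R ⧸ p))).minimalPrimes := by
    refine ⟨⟨inferInstance, Ideal.span_le.mpr fun z hz => ?_⟩, fun q hq _ z hz => ?_⟩
    · obtain ⟨r, hr, rfl⟩ : ∃ r ∈ rs, Ideal.Quotient.mk p r = z := by simpa [s] using hz
      have hmax : (maximalIdeal (R ⧸ p)).comap (Ideal.Quotient.mk p) = maximalIdeal R :=
        IsLocalRing.eq_maximalIdeal
          (Ideal.comap_isMaximal_of_surjective _ Ideal.Quotient.mk_surjective)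
      exact Ideal.mem_comap.mp (hmax ▸ hrs r hr)
    · obtain ⟨r, rfl⟩ := Ideal.Quotient.mk_surjective z
      have hr : r ∈ maximalIdeal R := fun hu => hz (hu.map (Ideal.Quotient.mk p))
      have : q.IsPrime := hq.1
      have hle : (p ⊔ Ideal.ofList rs).radical ≤ q.comap (Ideal.Quotient.mk p) := by
        rw [(Ideal.IsPrime.comap (Ideal.Quotient.mk p)).radical_le_iff]
        refine sup_le (fun a ha => ?_) (Ideal.span_le.mpr fun a ha => ?_)
        · rw [Ideal.mem_comap, Ideal.Quotient.eq_zero_iff_mem.mpr ha]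
          exact q.zero_mem
        · exact hq.2 (Ideal.subset_span (by
            simpa [s] using ⟨a, ha, rfl⟩))
      exact hle (h hr)
  rw [← IsLocalRing.maximalIdeal_height_eq_ringKrullDim]
  have h1 := Ideal.height_le_card_of_mem_minimalPrimes_span_finset hmin
  have h2 : s.card ≤ rs.length := by
    simpa using List.toFinset_card_le (rs.map (Ideal.Quotient.mk p))
  exact WithBot.coe_le_coe.mpr (h1.trans (by exact_mod_cast h2))

/-- Over a local ring, a sequence of elements that is a system of parameters for `M` and has
the length of some `M`-regular sequence is itself `M`-regular. -/
lemma isWeaklyRegular_of_isWeaklyRegular_of_maximalIdeal_le_radical (rs : List R) :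
    ∀ {M : Type u} [AddCommGroup M] [Module R M] [Module.Finite R M] [Nontrivial M]
    (ys : List R) (_ : ys.length = rs.length) (_ : ∀ y ∈ ys, y ∈ maximalIdeal R)
    (_ : IsWeaklyRegular M ys) (_ : ∀ r ∈ rs, r ∈ maximalIdeal R)
    (_ : maximalIdeal R ≤ (Module.annihilator R M ⊔ Ideal.ofList rs).radical),
    IsWeaklyRegular M rs := by
  induction rs with
  | nil => simp
  | cons x rs ih =>
    intro M _ _ _ _ ys hlen hys hreg hrs hrad
    have hxm := hrs x List.mem_cons_self
    have hrs' : ∀ r ∈ rs, r ∈ maximalIdeal R := fun r hr => hrs r (List.mem_cons_of_mem _ hr)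
    -- A zero divisor `x` lies in an associated prime `p`. Then `dim R / p` is at least `ys.length =
    -- rs.length + 1`, while the remaining `rs.length` elements already generate an ideal primary to
    -- the maximal ideal modulo `p`.
    have hx : IsSMulRegular M x := by
      by_contra hx
      have hmem : x ∈ ({ r : R | IsSMulRegular M r }ᶜ : Set R) := hx
      rw [← biUnion_associatedPrimes_eq_compl_regular] at hmem
      obtain ⟨p, hp, hxp⟩ := Set.mem_iUnion₂.mp hmem
      have : p.IsPrime := hp.isPrime
      have hann : Module.annihilator R M ≤ p := by
        rw [← Submodule.annihilator_top]
        exact IsAssociatedPrime.annihilator_le hp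
      have h1 := length_le_ringKrullDim_quotient_of_mem_associatedPrimes ys hys hreg hp
      have h2 := ringKrullDim_quotient_le_length (p := p) (hrad.trans (Ideal.radical_mono ?_)) hrs'
      · have h3 := h1.trans h2
        rw [hlen, List.length_cons] at h3
        norm_cast at h3
        lia
      · rw [Ideal.ofList_cons, ← sup_assoc]
        refine sup_le_sup_right (sup_le hann ?_) _
        exact (Ideal.span_singleton_le_iff_mem _).mpr hxp
    have hnt : Nontrivial (QuotSMulTop x M) := nontrivial_quotSMulTop_of_mem_maximalIdeal M hxm
    have hlt (N : Type u) [AddCommGroup N] [Module R N] [Module.Finite R N] [Nontrivial N] :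
        maximalIdeal R • (⊤ : Submodule R N) < ⊤ :=
      lt_top_iff_ne_top.mpr (Submodule.top_ne_ideal_smul_of_le_jacobson_annihilator
        (maximalIdeal_le_jacobson _)).symm
    -- The sequence `ys` need not begin with `x`, so a regular sequence of length `rs.length` on `M
    -- / x` is obtained through vanishing of Ext from the residue field.
    let k := ModuleCat.of R (R ⧸ maximalIdeal R)
    have hsupp : Module.support R k = PrimeSpectrum.zeroLocus (maximalIdeal R) := by
      rw [Module.support_eq_zeroLocus, Ideal.annihilator_quotient]
    have hext := ModuleCat.subsingleton_ext_of_exists_isRegular (maximalIdeal R) k hsupp.le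
      (ModuleCat.of R M) (hlt M) ys hys
      (IsRegular.of_isWeaklyRegular_of_mem_maximalIdeal M hys hreg)
    have hext' := subsingleton_ext_quotSMulTop (M := ModuleCat.of R M) (N := k) hx
      (n := rs.length) (fun i hi => hext i (by rw [hlen]; exact hi))
    obtain ⟨zs, hzlen, hzs, hzreg⟩ := ModuleCat.exists_isRegular_of_exists_subsingleton_ext
      (maximalIdeal R) rs.length (ModuleCat.of R (QuotSMulTop x M)) (hlt _) k hsupp hext'
    refine IsWeaklyRegular.cons hx (ih zs hzlen hzs hzreg.toIsWeaklyRegular hrs'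
      (hrad.trans (Ideal.radical_mono ?_)))
    rw [Ideal.ofList_cons, ← sup_assoc]
    refine sup_le_sup_right (sup_le ?_ ?_) _
    · exact (Submodule.mkQ (x • (⊤ : Submodule R M))).annihilator_le_of_surjective
        (Submodule.mkQ_surjective _)
    · exact (Ideal.span_singleton_le_iff_mem _).mpr (QuotSMulTop.mem_annihilator M x)

/-- In a Cohen–Macaulay local ring every sequence of parameters is regular. -/
lemma IsParameterSequence.isWeaklyRegular (hCM : IsCohenMacaulay R) {rs : List R}
    (h : IsParameterSequence R rs) : IsWeaklyRegular R rs := by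
  obtain ⟨hlen, hrad⟩ := h
  rw [← IsLocalRing.maximalIdeal_height_eq_ringKrullDim] at hlen
  obtain ⟨ys, hys, hmem, hreg⟩ := hCM.exists_isWeaklyRegular (maximalIdeal R)
    (WithBot.coe_injective hlen).symm
  refine isWeaklyRegular_of_isWeaklyRegular_of_maximalIdeal_le_radical rs ys.reverse
    (by simpa using hys) (by simpa using hmem) hreg (fun r hr => ?_) ?_
  · rw [← hrad]
    exact Ideal.le_radical (Ideal.subset_span hr)
  · exact hrad.ge.trans (Ideal.radical_mono le_sup_right)

variable (R) in
-- By the converse of Krull's height theorem the maximal ideal is minimal over an ideal with as many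
-- generators as its height. In a local ring it is then the only prime over that ideal.
lemma exists_isParameterSequence : ∃ rs : List R, IsParameterSequence R rs := by
  obtain ⟨s, hs, hcard⟩ :=
    (maximalIdeal R).exists_finset_card_eq_height_of_isNoetherianRing
  have hspan : Ideal.ofList s.toList = Ideal.span (s : Set R) := by
    simp [Ideal.ofList]
  refine ⟨s.toList, ?_, ?_⟩
  · rw [Finset.length_toList, hcard, IsLocalRing.maximalIdeal_height_eq_ringKrullDim]
  · rw [hspan]
    refine le_antisymm ((Ideal.IsPrime.radical_le_iff inferInstance).mpr hs.1.2) ?_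
    rw [Ideal.radical_eq_sInf]
    refine le_sInf fun q hq => ?_
    have := hq.2
    exact hs.2 ⟨hq.2, hq.1⟩ (IsLocalRing.le_maximalIdeal hq.2.ne_top)

end Dimension

lemma IsParameterSequence.reverse {R : Type u} [CommRing R] [IsLocalRing R] {rs : List R}
    (h : IsParameterSequence R rs) : IsParameterSequence R rs.reverse :=
  ⟨by rw [List.length_reverse]; exact h.1, by rw [ofList_reverse]; exact h.2⟩

/-- In a nonzero ring of finite Krull dimension some maximal ideal has height `dim R`. -/
lemma exists_isMaximal_height_eq_ringKrullDim (R : Type u) [CommRing R] [Nontrivial R]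
    (hdim : ringKrullDim R ≠ ⊤) :
    ∃ (m : Ideal R) (d : ℕ), m.IsMaximal ∧ m.height = d ∧ ringKrullDim R = (d : ℕ∞) := by
  obtain ⟨d, hd⟩ : ∃ d : ℕ, ringKrullDim R = (d : ℕ∞) := by
    obtain ⟨e, he⟩ := WithBot.ne_bot_iff_exists.mp (ne_of_gt (lt_of_lt_of_le (WithBot.bot_lt_coe 0) (ringKrullDim_nonneg_of_nontrivial (R := R))))
    have he' : e ≠ ⊤ := by
      rintro rfl
      exact hdim he.symm
    lift e to ℕ using he'
    exact ⟨e, he.symm⟩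
  have hle (m : Ideal R) (hm : m.IsMaximal) : m.height ≤ d := by
    have := (ringKrullDim_le_iff_isMaximal_height_le (R := R) _).mp hd.le hm
    exact WithBot.coe_le_coe.mp this
  -- If no maximal ideal had height `d`, all their heights, and hence `dim R`, would be at most `d -
  -- 1`.
  by_contra! hne
  have hlt : ∀ m : Ideal R, m.IsMaximal → m.height + 1 ≤ d := fun m hm =>
    Order.add_one_le_of_lt (lt_of_le_of_ne (hle m hm) fun h => hne m d hm h hd)
  cases d with
  | zero =>
    obtain ⟨m, hm⟩ := Ideal.exists_maximal R
    simpa using hlt m hm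
  | succ d =>
    have : ringKrullDim R ≤ ((d : ℕ∞) : WithBot ℕ∞) := by
      rw [ringKrullDim_le_iff_isMaximal_height_le]
      intro m hm
      have := hlt m hm
      push_cast at this
      exact WithBot.coe_le_coe.mpr ((ENat.add_le_add_iff_right ENat.one_ne_top).mp this)
    rw [hd] at this
    norm_cast at this
    lia

end CohenMacaulay

theorem mainTheorem8 (R : Type u) [CommRing R] [IsNoetherianRing R]
    [HasDerivedCategory.{w} (ModuleCat.{u} R)]
    (hCM : IsCohenMacaulay R) (hdim : ringKrullDim R ≠ ⊤) :
    (∃ F : CochainComplex (ModuleCat.{u} R) ℤ, IsBoundedFiniteFree R F ∧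
      ringKrullDim R + 1 ≤ ((gLevel.{w} R F : ℕ∞) : WithBot ℕ∞)) ∧
    (∀ [IsLocalRing R],
      (∃ rs : List R, IsParameterSequence R rs) ∧
      ∀ rs : List R, IsParameterSequence R rs →
        IsBoundedFiniteFree R (koszulComplex R rs) ∧
        ((gLevel.{w} R (koszulComplex R rs) : ℕ∞) : WithBot ℕ∞) = ringKrullDim R + 1) := by
  refine ⟨?_, fun {_} => ⟨exists_isParameterSequence R, fun rs hrs =>
    ⟨isBoundedFiniteFree_koszulComplex rs, ?_⟩⟩⟩
  · rcases subsingleton_or_nontrivial R with hR | hR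
    -- The zero ring has dimension `⊥`, so any complex will do.
    · refine ⟨koszulComplex R [], isBoundedFiniteFree_koszulComplex [], ?_⟩
      rw [ringKrullDim_eq_bot_of_subsingleton, WithBot.bot_add]
      exact bot_le
    · obtain ⟨m, d, hm, hd, hd'⟩ := exists_isMaximal_height_eq_ringKrullDim R hdim
      obtain ⟨xs, hlen, hmem, hreg⟩ := hCM.exists_isWeaklyRegular m hd
      refine ⟨koszulComplex R xs, isBoundedFiniteFree_koszulComplex xs, ?_⟩
      rw [gLevel_koszulComplex hreg hm.ne_top hmem, hd', hlen]
      rfl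
  · have hmem : ∀ r ∈ rs, r ∈ IsLocalRing.maximalIdeal R := fun r hr => by
      rw [← hrs.2]
      exact Ideal.le_radical (Ideal.subset_span hr)
    -- Being a sequence of parameters does not depend on the order, so the reversed list is regular
    -- too.
    rw [gLevel_koszulComplex (hrs.reverse.isWeaklyRegular hCM) Ideal.IsPrime.ne_top' hmem, ← hrs.1]
    rfl
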